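/- Let $m\ge 2$ and $\kappa\in(0,1)$, and let $d>0$. There exists $\varepsilon>0$, depending only on $m$, $\kappa$ and $d$, such that the following holds for every $n\ge 1$, every bounded convex $C^2$ domain $\Omega\subset\mathbb{R}^m$ with $\operatorname{diam}\Omega\le d$, and every $T>0$. Let $\mathbb{R}^{m+n}_n$ be $\mathbb{R}^m\times\mathbb{R}^n$ with the metric $\langle v,w\rangle=\sum_{i=1}^m v^iw^i-\sum_{\gamma=m+1}^{m+n}v^\gamma w^\gamma$. Let $u:\overline\Omega\times[0,T]\to\mathbb{R}^n$ be a spacelike graphic mean curvature flow in $\mathbb{R}^{m+n}_n$: that is, $u$ is smooth on $\Omega\times(0,T)$ and $C^1$ on $\overline\Omega\times[0,T]$; for each $t\in[0,T]$ the graph of $u(\cdot,t)$ over $\Omega$ is spacelike, i.e. its induced metric $g(Du)=I-Du^{T}Du$ is positive definite ($D$ is the derivative in $x\in\mathbb{R}^m$ only); and $$\frac{\partial u}{\partial t}=g^{ij}(Du)\,\frac{\partial^2u}{\partial x^i\partial x^j}\quad\text{on }\Omega\times(0,T),$$ where $(g^{ij})$ is the inverse of $g$. Let $\phi:\overline\Omega\times[0,T]\to\mathbb{R}^n$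 be of parabolic class $C^2$, i.e. $\phi$, $D\phi$, $D^2\phi$ and $\partial\phi/\partial t$ exist and are continuous on $\overline\Omega\times[0,T]$, and suppose that $u(x,t)=\phi(x,t)$ whenever $x\in\partial\Omega$ or $t=0$. Write $|||A|||=\sup_{|v|=1}|Av|$ for linear maps $A:\mathbb{R}^m\to\mathbb{R}^n$ and $|||B|||=\sup_{|v|=1}|B(v,v)|$ for bilinear maps $B:\mathbb{R}^m\times\mathbb{R}^m\to\mathbb{R}^n$. If the parabolic $C^2$ norm of $\phi$ satisfies $$\sup_{\overline\Omega\times[0,T]}|\phi|+\sup_{\overline\Omega\times[0,T]}|||D\phi|||+\sup_{\overline\Omega\times[0,T]}|||D^2\phi|||+\sup_{\overline\Omega\times[0,T]}\left|\frac{\partial\phi}{\partial t}\right|<\varepsilon,$$ then $$\sup_{\Omega}|||Du(\cdot,t)|||^2<1-\kappa\qquad\text{for all }t\in[0,T].$$ -/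

import Mathlib

open Set Topology
open scoped ENNReal ContDiff Matrix

/-- The boundary of `Ω` is of class `C²`: near each boundary point, `Ω` is the negativity set of a
`C²` function with non-vanishing differential at that point. -/
def HasC2Boundary {m : ℕ} (Ω : Set (EuclideanSpace ℝ (Fin m))) : Prop :=
  ∀ p ∈ frontier Ω, ∃ U : Set (EuclideanSpace ℝ (Fin m)), IsOpen U ∧ p ∈ U ∧
    ∃ ρ : EuclideanSpace ℝ (Fin m) → ℝ, ContDiffOn ℝ 2 ρ U ∧ fderiv ℝ ρ p ≠ 0 ∧
      Ω ∩ U = {x ∈ U | ρ x < 0}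

/-- A bounded, convex, `C²` domain (non-empty open set; connected because it is convex). -/
structure IsBoundedConvexC2Domain {m : ℕ} (Ω : Set (EuclideanSpace ℝ (Fin m))) : Prop where
  isOpen : IsOpen Ω
  nonempty : Ω.Nonempty
  convex : Convex ℝ Ω
  isBounded : Bornology.IsBounded Ω
  c2Boundary : HasC2Boundary Ω

/-- The closed cylinder `Ω̄ × [0, T]`. -/
def closedCylinder {m : ℕ} (Ω : Set (EuclideanSpace ℝ (Fin m))) (T : ℝ) :
    Set (EuclideanSpace ℝ (Fin m) × ℝ) :=
  closure Ω ×ˢ Icc 0 T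

section Derivatives

variable {m n : ℕ} (Ω : Set (EuclideanSpace ℝ (Fin m))) (T : ℝ)
  (u : EuclideanSpace ℝ (Fin m) → ℝ → EuclideanSpace ℝ (Fin n))

/-- The space derivative `Du(x, t)`, taken within `Ω̄`, so that it makes sense up to the boundary.
On the open set `Ω` it is the ordinary derivative. -/
noncomputable def spaceDeriv (x : EuclideanSpace ℝ (Fin m)) (t : ℝ) :
    EuclideanSpace ℝ (Fin m) →L[ℝ] EuclideanSpace ℝ (Fin n) :=
  fderivWithin ℝ (fun y => u y t) (closure Ω) x

/-- The second space derivative `D²u(x, t)`, taken within `Ω̄`. -/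
noncomputable def spaceDeriv2 (x : EuclideanSpace ℝ (Fin m)) (t : ℝ) :
    EuclideanSpace ℝ (Fin m) →L[ℝ] EuclideanSpace ℝ (Fin m) →L[ℝ] EuclideanSpace ℝ (Fin n) :=
  fderivWithin ℝ (fun y => spaceDeriv Ω u y t) (closure Ω) x

/-- The time derivative `∂u/∂t (x, t)`, one-sided at the end points of `[0, T]`. -/
noncomputable def timeDeriv (x : EuclideanSpace ℝ (Fin m)) (t : ℝ) : EuclideanSpace ℝ (Fin n) :=
  derivWithin (fun s => u x s) (Icc 0 T) t

end Derivatives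

section Norms

variable {m n : ℕ}

/-- `|||A||| = sup_{|v| = 1} |A v|`. -/
noncomputable def tripleNorm (A : EuclideanSpace ℝ (Fin m) →L[ℝ] EuclideanSpace ℝ (Fin n)) :
    ℝ≥0∞ :=
  ⨆ v ∈ Metric.sphere (0 : EuclideanSpace ℝ (Fin m)) 1, ‖A v‖ₑ

/-- `|||B||| = sup_{|v| = 1} |B(v, v)|`. -/
noncomputable def tripleNorm2
    (B : EuclideanSpace ℝ (Fin m) →L[ℝ] EuclideanSpace ℝ (Fin m) →L[ℝ] EuclideanSpace ℝ (Fin n)) :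
    ℝ≥0∞ :=
  ⨆ v ∈ Metric.sphere (0 : EuclideanSpace ℝ (Fin m)) 1, ‖B v v‖ₑ

end Norms

/-- `φ` is of parabolic class `C²` on `Ω̄ × [0, T]`: the derivatives `Dφ`, `D²φ` and `∂φ/∂t` exist,
and they and `φ` are continuous on `Ω̄ × [0, T]`. -/
structure IsParabolicC2 {m n : ℕ} (Ω : Set (EuclideanSpace ℝ (Fin m))) (T : ℝ)
    (φ : EuclideanSpace ℝ (Fin m) → ℝ → EuclideanSpace ℝ (Fin n)) : Prop where
  contDiff_space : ∀ t ∈ Icc 0 T, ContDiffOn ℝ 2 (fun x => φ x t) (closure Ω)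
  differentiable_time : ∀ x ∈ closure Ω, DifferentiableOn ℝ (fun t => φ x t) (Icc 0 T)
  continuous : ContinuousOn (fun p => φ p.1 p.2) (closedCylinder Ω T)
  continuous_spaceDeriv : ContinuousOn (fun p => spaceDeriv Ω φ p.1 p.2) (closedCylinder Ω T)
  continuous_spaceDeriv2 : ContinuousOn (fun p => spaceDeriv2 Ω φ p.1 p.2) (closedCylinder Ω T)
  continuous_timeDeriv : ContinuousOn (fun p => timeDeriv T φ p.1 p.2) (closedCylinder Ω T)

/-- The parabolic `C²` norm `sup |φ| + sup |||Dφ||| + sup |||D²φ||| + sup |∂φ/∂t|`, the suprema being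
over `Ω̄ × [0, T]`. -/
noncomputable def parabolicC2Norm {m n : ℕ} (Ω : Set (EuclideanSpace ℝ (Fin m))) (T : ℝ)
    (φ : EuclideanSpace ℝ (Fin m) → ℝ → EuclideanSpace ℝ (Fin n)) : ℝ≥0∞ :=
  (⨆ p ∈ closedCylinder Ω T, ‖φ p.1 p.2‖ₑ)
    + (⨆ p ∈ closedCylinder Ω T, tripleNorm (spaceDeriv Ω φ p.1 p.2))
    + (⨆ p ∈ closedCylinder Ω T, tripleNorm2 (spaceDeriv2 Ω φ p.1 p.2))
    + (⨆ p ∈ closedCylinder Ω T, ‖timeDeriv T φ p.1 p.2‖ₑ)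

/-- The metric `⟨v, w⟩ = ∑_{i ≤ m} vⁱ wⁱ - ∑_{γ > m} v^γ w^γ` of the semi-Euclidean space
`ℝ^{m+n}_n = ℝ^m × ℝ^n`. -/
noncomputable def semiEuclideanForm {m n : ℕ}
    (v w : EuclideanSpace ℝ (Fin m) × EuclideanSpace ℝ (Fin n)) : ℝ :=
  inner ℝ v.1 w.1 - inner ℝ v.2 w.2

/-- The matrix `(g_{ij})` of the metric induced on a graph with derivative `A`: the entries are the
products of the tangent vectors `(e_i, A e_i)`, that is, `g = I - Aᵀ A`. -/
noncomputable def inducedMetric {m n : ℕ}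
    (A : EuclideanSpace ℝ (Fin m) →L[ℝ] EuclideanSpace ℝ (Fin n)) : Matrix (Fin m) (Fin m) ℝ :=
  Matrix.of fun i j => semiEuclideanForm
    (EuclideanSpace.single i (1 : ℝ), A (EuclideanSpace.single i (1 : ℝ)))
    (EuclideanSpace.single j (1 : ℝ), A (EuclideanSpace.single j (1 : ℝ)))

/-- `u` is a spacelike graphic mean curvature flow in `ℝ^{m+n}_n` over `Ω` for the times `[0, T]`:
it is smooth on `Ω × (0, T)` and `C¹` on the closure, the graphs of `u(·, t)`, `t ∈ [0, T]`, over `Ω`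
are spacelike, and `∂u/∂t = g^{ij}(Du) ∂²u/∂xⁱ∂xʲ` on `Ω × (0, T)`. -/
structure IsSpacelikeGraphicMCF {m n : ℕ} (Ω : Set (EuclideanSpace ℝ (Fin m))) (T : ℝ)
    (u : EuclideanSpace ℝ (Fin m) → ℝ → EuclideanSpace ℝ (Fin n)) : Prop where
  smooth : ContDiffOn ℝ ∞ (fun p : EuclideanSpace ℝ (Fin m) × ℝ => u p.1 p.2) (Ω ×ˢ Ioo 0 T)
  c1_closure : ContDiffOn ℝ 1 (fun p : EuclideanSpace ℝ (Fin m) × ℝ => u p.1 p.2)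
    (closedCylinder Ω T)
  spacelike : ∀ x ∈ Ω, ∀ t ∈ Icc 0 T, (inducedMetric (spaceDeriv Ω u x t)).PosDef
  flow : ∀ x ∈ Ω, ∀ t ∈ Ioo 0 T,
    timeDeriv T u x t = ∑ i, ∑ j, (inducedMetric (spaceDeriv Ω u x t))⁻¹ i j •
      spaceDeriv2 Ω u x t (EuclideanSpace.single i (1 : ℝ)) (EuclideanSpace.single j (1 : ℝ))

/-!
Let `ξ₁, …, ξₘ` be the columns of the positive square root of `(gⁱʲ)`, so that the flow reads
`∂ₜu = ∑ₖ D²u(ξₖ, ξₖ)`. As long as `|Du|² ≤ 1/2`, a bound `|u(x, t) - u(y, t)| ≤ L |x - y|` with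
`L ≤ 1` propagates from the parabolic boundary: at a maximum in `(x, y)` of
`|u(x, t) - u(y, t)|² - L² |x - y|²`, move `x` along `ξₖ` and `y` along the corresponding `ηₖ`. The
quadratic error `L² ∑ |ξₖ - ηₖ|²` is absorbed because `∑ |ξₖ - ηₖ|² ≤ ∑ |Du ξₖ - Du ηₖ|²`.

On the lateral boundary the bound comes from a barrier: if `ℓ` is the distance to a supporting
hyperplane at `x₀ ∈ ∂Ω`, the multiple `(m + 1/2) ε` of the concave function `ℓ (2d - ℓ)` dominates
every component of `u - φ`.

The a priori smallness of `Du` is removed by continuity: at the first time at which `|Du|²` reached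
`1/2`, the bound just obtained would still hold, and it is better.
-/

section Linear

open scoped MatrixOrder

variable {ι κ : Type*} [Fintype ι] [Fintype κ]

theorem one_le_of_one_le_mul_self {R : Type*} [Ring R] [StarRing R] [PartialOrder R]
    [StarOrderedRing R] [TopologicalSpace R] [Algebra ℝ R]
    [ContinuousFunctionalCalculus ℝ R IsSelfAdjoint] [NonnegSpectrumClass ℝ R] {a : R}
    (ha : 0 ≤ a) (h : 1 ≤ a * a) : 1 ≤ a := by
  rw [CFC.one_le_iff (R := ℝ) a ha.isSelfAdjoint]
  intro x hx
  have hx0 : 0 ≤ x := spectrum_nonneg_of_nonneg ha hx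
  have haa : IsSelfAdjoint (a * a) := (IsSelfAdjoint.of_nonneg zero_le_one).of_ge h
  have hxx := (CFC.one_le_iff (R := ℝ) (a * a) haa).1 h _ (sq a ▸ spectrum.pow_mem_pow a 2 hx)
  exact (one_le_sq_iff₀ hx0).1 hxx

theorem trace_transpose_mul_self_nonneg (X : Matrix κ ι ℝ) : 0 ≤ (Xᵀ * X).trace := by
  simpa using (Matrix.posSemidef_conjTranspose_mul_self X).trace_nonneg

theorem trace_transpose_mul_mul_le {M N : Matrix ι ι ℝ} (h : M ≤ N) (X : Matrix ι κ ℝ) :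
    (Xᵀ * M * X).trace ≤ (Xᵀ * N * X).trace := by
  have := ((Matrix.le_iff.1 h).conjTranspose_mul_mul_same X).trace_nonneg
  simpa [Matrix.mul_sub, Matrix.sub_mul] using this

-- From `P² - Q² = CᵀC - DᵀD` one gets `2|X|² ≤ tr X(P + Q)X = tr X(CᵀE + DᵀE)` for `X = P - Q`
-- and `E = C - D`, and AM–GM bounds the right-hand side by `|X|² + |E|²`.
theorem trace_transpose_mul_self_sub_le [DecidableEq ι] {P Q : Matrix ι ι ℝ} {C D : Matrix κ ι ℝ}
    (hP : 0 ≤ P) (hQ : 0 ≤ Q) (hPC : P * P = 1 + Cᵀ * C) (hQD : Q * Q = 1 + Dᵀ * D)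
    (hC : Cᵀ * C ≤ 1) (hD : Dᵀ * D ≤ 1) :
    ((P - Q)ᵀ * (P - Q)).trace ≤ ((C - D)ᵀ * (C - D)).trace := by
  have one_le {R : Matrix ι ι ℝ} {G : Matrix κ ι ℝ} (hR : 0 ≤ R) (h : R * R = 1 + Gᵀ * G) :
      1 ≤ R :=
    one_le_of_one_le_mul_self hR (by
      simpa [h, Matrix.le_iff] using Matrix.posSemidef_conjTranspose_mul_self G)
  set X := P - Q with hX
  set E := C - D with hE
  have hXt : Xᵀ = X := by
    simpa [hX, IsSelfAdjoint, Matrix.star_eq_conjTranspose] using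
      (hP.isSelfAdjoint.sub hQ.isSelfAdjoint)
  have lower : 2 * (Xᵀ * X).trace ≤ (Xᵀ * P * X).trace + (Xᵀ * Q * X).trace := by
    have hPX := trace_transpose_mul_mul_le (one_le hP hPC) X
    have hQX := trace_transpose_mul_mul_le (one_le hQ hQD) X
    rw [Matrix.mul_one] at hPX hQX
    linarith
  have amgm (G : Matrix κ ι ℝ) (hG : Gᵀ * G ≤ 1) :
      2 * (Xᵀ * (Gᵀ * E)).trace ≤ (Xᵀ * X).trace + (Eᵀ * E).trace := by
    have hsq := trace_transpose_mul_self_nonneg (G * X - E)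
    have hGX := trace_transpose_mul_mul_le hG X
    have hcross : (Eᵀ * (G * X)).trace = (Xᵀ * (Gᵀ * E)).trace := by
      rw [← Matrix.trace_transpose]; simp [Matrix.mul_assoc]
    simp only [Matrix.transpose_sub, Matrix.transpose_mul, Matrix.sub_mul, Matrix.mul_sub,
      Matrix.trace_sub, hcross, Matrix.mul_assoc, Matrix.one_mul] at hsq hGX
    linarith
  have key : (Xᵀ * P * X).trace + (Xᵀ * Q * X).trace
      = (Xᵀ * (Cᵀ * E)).trace + (Xᵀ * (Dᵀ * E)).trace := by
    have hcomm : (X * Q * X).trace = (X * X * Q).trace := by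
      rw [Matrix.trace_mul_comm, Matrix.mul_assoc]
    have hdiff : P * X + X * Q = Cᵀ * E + Eᵀ * D := by
      rw [hX, hE, Matrix.mul_sub, Matrix.sub_mul, hPC, hQD]
      simp only [Matrix.mul_sub, Matrix.transpose_sub, Matrix.sub_mul]
      abel
    have hswap : (X * (Eᵀ * D)).trace = (X * (Dᵀ * E)).trace := by
      rw [← Matrix.trace_transpose, Matrix.transpose_mul, Matrix.transpose_mul,
        Matrix.transpose_transpose, hXt, Matrix.trace_mul_comm]
    rw [hXt, hcomm, Matrix.mul_assoc, Matrix.mul_assoc, ← hswap, ← Matrix.trace_add,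
      ← Matrix.trace_add, ← Matrix.mul_add, hdiff, Matrix.mul_add]
  linarith [amgm C hC, amgm D hD]

end Linear

section Frame

open scoped MatrixOrder

variable {m n : ℕ}

/-- The matrix of `A` in the standard bases. -/
noncomputable def jacobianMatrix (A : EuclideanSpace ℝ (Fin m) →L[ℝ] EuclideanSpace ℝ (Fin n)) :
    Matrix (Fin n) (Fin m) ℝ :=
  Matrix.of fun i j => A (EuclideanSpace.single j 1) i

theorem toLp_jacobianMatrix_mulVec (A : EuclideanSpace ℝ (Fin m) →L[ℝ] EuclideanSpace ℝ (Fin n))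
    (v : Fin m → ℝ) : WithLp.toLp 2 (jacobianMatrix A *ᵥ v) = A (WithLp.toLp 2 v) := by
  have hv : WithLp.toLp 2 v = ∑ j, v j • EuclideanSpace.single j (1 : ℝ) := by
    ext i; simp [Pi.single_apply]
  ext i
  simp [hv, jacobianMatrix, Matrix.mulVec, dotProduct, mul_comm]

theorem inducedMetric_eq (A : EuclideanSpace ℝ (Fin m) →L[ℝ] EuclideanSpace ℝ (Fin n)) :
    inducedMetric A = 1 - (jacobianMatrix A)ᵀ * jacobianMatrix A := by
  ext i j
  simp [inducedMetric, semiEuclideanForm, jacobianMatrix, Matrix.mul_apply, PiLp.inner_apply,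
    Matrix.one_apply, mul_comm, eq_comm]

theorem dotProduct_transpose_mul_self_mulVec
    (A : EuclideanSpace ℝ (Fin m) →L[ℝ] EuclideanSpace ℝ (Fin n)) (v : Fin m → ℝ) :
    v ⬝ᵥ (((jacobianMatrix A)ᵀ * jacobianMatrix A) *ᵥ v) = ‖A (WithLp.toLp 2 v)‖ ^ 2 := by
  rw [← toLp_jacobianMatrix_mulVec, EuclideanSpace.norm_sq_eq, ← Matrix.mulVec_mulVec,
    Matrix.mulVec_transpose, dotProduct_comm, ← Matrix.dotProduct_mulVec]
  simp [dotProduct, sq]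

theorem transpose_mul_self_jacobianMatrix_le
    (A : EuclideanSpace ℝ (Fin m) →L[ℝ] EuclideanSpace ℝ (Fin n)) :
    (jacobianMatrix A)ᵀ * jacobianMatrix A ≤ ‖A‖ ^ 2 • 1 := by
  refine Matrix.le_iff.2 (.of_dotProduct_mulVec_nonneg ?_ fun v => ?_)
  · simp [Matrix.IsHermitian, Matrix.transpose_sub, Matrix.transpose_mul]
  · have hAv : ‖A (WithLp.toLp 2 v)‖ ^ 2 ≤ ‖A‖ ^ 2 * (v ⬝ᵥ v) := by
      calc ‖A (WithLp.toLp 2 v)‖ ^ 2 ≤ (‖A‖ * ‖WithLp.toLp 2 v‖) ^ 2 :=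
            pow_le_pow_left₀ (norm_nonneg _) (A.le_opNorm _) 2
        _ = ‖A‖ ^ 2 * (v ⬝ᵥ v) := by
          rw [mul_pow, EuclideanSpace.norm_sq_eq]
          simp [dotProduct, sq]
    simpa [Matrix.sub_mulVec, Matrix.smul_mulVec, dotProduct_sub,
      dotProduct_transpose_mul_self_mulVec] using hAv

theorem lt_one_of_sq_le_half {r : ℝ} (hr : r ^ 2 ≤ 1 / 2) : r < 1 := by
  nlinarith

theorem posDef_inducedMetric {A : EuclideanSpace ℝ (Fin m) →L[ℝ] EuclideanSpace ℝ (Fin n)}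
    (hA : ‖A‖ < 1) : (inducedMetric A).PosDef := by
  have hpos : (0 : ℝ) < 1 - ‖A‖ ^ 2 := by nlinarith [norm_nonneg A]
  have h := Matrix.le_iff.1 (transpose_mul_self_jacobianMatrix_le A)
  have hsum : inducedMetric A = (1 - ‖A‖ ^ 2) • (1 : Matrix (Fin m) (Fin m) ℝ)
      + (‖A‖ ^ 2 • 1 - (jacobianMatrix A)ᵀ * jacobianMatrix A) := by
    rw [inducedMetric_eq, sub_smul, one_smul]; abel
  rw [hsum]
  exact (Matrix.PosDef.one.smul hpos).add_posSemidef h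

/-- The positive square root of the inverse `(gⁱʲ)` of the induced metric. -/
noncomputable def inverseMetricRoot
    (A : EuclideanSpace ℝ (Fin m) →L[ℝ] EuclideanSpace ℝ (Fin n)) : Matrix (Fin m) (Fin m) ℝ :=
  CFC.sqrt (inducedMetric A)⁻¹

theorem inverseMetricRoot_nonneg
    (A : EuclideanSpace ℝ (Fin m) →L[ℝ] EuclideanSpace ℝ (Fin n)) : 0 ≤ inverseMetricRoot A :=
  CFC.sqrt_nonneg _

theorem transpose_inverseMetricRoot
    (A : EuclideanSpace ℝ (Fin m) →L[ℝ] EuclideanSpace ℝ (Fin n)) :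
    (inverseMetricRoot A)ᵀ = inverseMetricRoot A := by
  simpa [IsSelfAdjoint, Matrix.star_eq_conjTranspose] using
    (inverseMetricRoot_nonneg A).isSelfAdjoint

theorem inverseMetricRoot_mul_self
    {A : EuclideanSpace ℝ (Fin m) →L[ℝ] EuclideanSpace ℝ (Fin n)} (hA : ‖A‖ < 1) :
    inverseMetricRoot A * inverseMetricRoot A = (inducedMetric A)⁻¹ :=
  CFC.sqrt_mul_sqrt_self _ (posDef_inducedMetric hA).inv.posSemidef.nonneg

theorem inverseMetricRoot_mul_inducedMetric_mul
    {A : EuclideanSpace ℝ (Fin m) →L[ℝ] EuclideanSpace ℝ (Fin n)} (hA : ‖A‖ < 1) :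
    inverseMetricRoot A * inducedMetric A * inverseMetricRoot A = 1 := by
  rw [mul_eq_one_comm, ← Matrix.mul_assoc, inverseMetricRoot_mul_self hA]
  exact Matrix.nonsing_inv_mul _ (posDef_inducedMetric hA).det_pos.ne'.isUnit

theorem inverseMetricRoot_mul_self_eq_one_add
    {A : EuclideanSpace ℝ (Fin m) →L[ℝ] EuclideanSpace ℝ (Fin n)} (hA : ‖A‖ < 1) :
    inverseMetricRoot A * inverseMetricRoot A = 1 +
      (jacobianMatrix A * inverseMetricRoot A)ᵀ * (jacobianMatrix A * inverseMetricRoot A) := by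
  have h := inverseMetricRoot_mul_inducedMetric_mul hA
  rw [inducedMetric_eq, Matrix.mul_sub, Matrix.sub_mul, Matrix.mul_one, sub_eq_iff_eq_add] at h
  rw [Matrix.transpose_mul, transpose_inverseMetricRoot, h]
  simp only [Matrix.mul_assoc]

theorem transpose_mul_self_jacobianMatrix_mul_inverseMetricRoot_le
    {A : EuclideanSpace ℝ (Fin m) →L[ℝ] EuclideanSpace ℝ (Fin n)} (hA : ‖A‖ ^ 2 ≤ 1 / 2) :
    (jacobianMatrix A * inverseMetricRoot A)ᵀ * (jacobianMatrix A * inverseMetricRoot A) ≤ 1 := by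
  set J := jacobianMatrix A
  set P := inverseMetricRoot A
  have hPP : P * P = 1 + (J * P)ᵀ * (J * P) :=
    inverseMetricRoot_mul_self_eq_one_add (lt_one_of_sq_le_half hA)
  have hJ : Jᵀ * J + Jᵀ * J ≤ 1 := by
    have h := (transpose_mul_self_jacobianMatrix_le A).trans
      (smul_le_smul_of_nonneg_right hA zero_le_one)
    calc Jᵀ * J + Jᵀ * J ≤ (1 / 2 : ℝ) • 1 + (1 / 2 : ℝ) • 1 := add_le_add h h
      _ = 1 := by rw [← add_smul]; norm_num
  have hPJ := star_left_conjugate_le_conjugate hJ P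
  have hconj : star P * (Jᵀ * J + Jᵀ * J) * P = (J * P)ᵀ * (J * P) + (J * P)ᵀ * (J * P) := by
    simp [Matrix.star_eq_conjTranspose, Matrix.mul_add, Matrix.add_mul, Matrix.mul_assoc]
  rw [hconj, mul_one, (inverseMetricRoot_nonneg A).star_eq, hPP] at hPJ
  exact le_of_add_le_add_right hPJ

/-- The columns `ξ₁, …, ξₘ` of the root of `(gⁱʲ)`: an orthonormal frame of the induced metric for
which `gⁱʲ Bᵢⱼ = ∑ₖ B(ξₖ, ξₖ)`. -/
noncomputable def metricFrame (A : EuclideanSpace ℝ (Fin m) →L[ℝ] EuclideanSpace ℝ (Fin n))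
    (k : Fin m) : EuclideanSpace ℝ (Fin m) :=
  WithLp.toLp 2 ((inverseMetricRoot A).col k)

theorem map_metricFrame (A : EuclideanSpace ℝ (Fin m) →L[ℝ] EuclideanSpace ℝ (Fin n))
    (k : Fin m) :
    A (metricFrame A k) = WithLp.toLp 2 ((jacobianMatrix A * inverseMetricRoot A).col k) := by
  rw [metricFrame, ← toLp_jacobianMatrix_mulVec]; rfl

theorem sum_inv_inducedMetric_smul {A : EuclideanSpace ℝ (Fin m) →L[ℝ] EuclideanSpace ℝ (Fin n)}
    (hA : ‖A‖ < 1) {F : Type*} [NormedAddCommGroup F] [NormedSpace ℝ F]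
    (B : EuclideanSpace ℝ (Fin m) →L[ℝ] EuclideanSpace ℝ (Fin m) →L[ℝ] F) :
    ∑ i, ∑ j, (inducedMetric A)⁻¹ i j •
        B (EuclideanSpace.single i (1 : ℝ)) (EuclideanSpace.single j (1 : ℝ))
      = ∑ k, B (metricFrame A k) (metricFrame A k) := by
  have expand (k : Fin m) : metricFrame A k
      = ∑ i, inverseMetricRoot A i k • EuclideanSpace.single i (1 : ℝ) := by
    ext i; simp [metricFrame, Pi.single_apply]
  have entry (i j : Fin m) : (inducedMetric A)⁻¹ i j
      = ∑ k, inverseMetricRoot A i k * inverseMetricRoot A j k := by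
    rw [← inverseMetricRoot_mul_self hA, Matrix.mul_apply]
    congr! 2 with k
    exact congrFun₂ (transpose_inverseMetricRoot A).symm k j
  set e : Fin m → EuclideanSpace ℝ (Fin m) := fun i => EuclideanSpace.single i 1
  set P := inverseMetricRoot A
  have frame_value (k : Fin m) : B (metricFrame A k) (metricFrame A k)
      = ∑ i, ∑ j, (P i k * P j k) • B (e i) (e j) := by
    simp only [expand, map_sum, map_smul, sum_apply, smul_apply, Finset.smul_sum, smul_smul]
    rw [Finset.sum_comm]
    exact Finset.sum_congr rfl fun i _ => Finset.sum_congr rfl fun j _ => by rw [mul_comm]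
  simp only [entry, frame_value, Finset.sum_smul]
  exact (Finset.sum_congr rfl fun i _ => Finset.sum_comm).trans Finset.sum_comm

theorem sum_norm_toLp_col_sq {ι κ : Type*} [Fintype ι] [Fintype κ] (X : Matrix κ ι ℝ) :
    ∑ i, ‖(WithLp.toLp 2 (X.col i) : EuclideanSpace ℝ κ)‖ ^ 2 = (Xᵀ * X).trace := by
  simp only [EuclideanSpace.norm_sq_eq, Real.norm_eq_abs, sq_abs]
  simp [Matrix.trace, Matrix.mul_apply, sq]

theorem sum_norm_toLp_col_sub_sq {ι κ : Type*} [Fintype ι] [Fintype κ] (X Y : Matrix κ ι ℝ) :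
    ∑ i, ‖(WithLp.toLp 2 (X.col i) - WithLp.toLp 2 (Y.col i) : EuclideanSpace ℝ κ)‖ ^ 2
      = ((X - Y)ᵀ * (X - Y)).trace :=
  sum_norm_toLp_col_sq (X - Y)

theorem sum_norm_metricFrame_sq_le
    {A : EuclideanSpace ℝ (Fin m) →L[ℝ] EuclideanSpace ℝ (Fin n)} (hA : ‖A‖ ^ 2 ≤ 1 / 2) :
    ∑ k, ‖metricFrame A k‖ ^ 2 ≤ 2 * m := by
  have hle := (Matrix.le_iff.1
    (transpose_mul_self_jacobianMatrix_mul_inverseMetricRoot_le hA)).trace_nonneg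
  simp only [metricFrame]
  rw [sum_norm_toLp_col_sq, transpose_inverseMetricRoot,
    inverseMetricRoot_mul_self_eq_one_add (lt_one_of_sq_le_half hA), Matrix.trace_add]
  rw [Matrix.trace_sub] at hle
  simp only [Matrix.trace_one, Fintype.card_fin] at hle ⊢
  linarith

theorem norm_sq_le_sum_inner_metricFrame_sq
    {A : EuclideanSpace ℝ (Fin m) →L[ℝ] EuclideanSpace ℝ (Fin n)} (hA : ‖A‖ < 1)
    (v : EuclideanSpace ℝ (Fin m)) : ‖v‖ ^ 2 ≤ ∑ k, inner ℝ v (metricFrame A k) ^ 2 := by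
  set P := inverseMetricRoot A with hP
  have hPP : 1 ≤ P * P := by
    rw [hP, inverseMetricRoot_mul_self_eq_one_add hA]
    simpa [Matrix.le_iff] using Matrix.posSemidef_conjTranspose_mul_self (jacobianMatrix A * P)
  have hnonneg := (Matrix.le_iff.1 hPP).dotProduct_mulVec_nonneg v.ofLp
  have hv : v.ofLp ⬝ᵥ v.ofLp = ‖v‖ ^ 2 := by
    rw [EuclideanSpace.norm_sq_eq]; simp [dotProduct, sq]
  have hPv : v.ofLp ⬝ᵥ ((P * P) *ᵥ v.ofLp) = ∑ k, inner ℝ v (metricFrame A k) ^ 2 := by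
    have hk (k : Fin m) : inner ℝ v (metricFrame A k) = (Pᵀ *ᵥ v.ofLp) k := by
      simp [Matrix.mulVec, dotProduct, PiLp.inner_apply, metricFrame, P]
    simp only [hk, transpose_inverseMetricRoot, P]
    rw [← Matrix.mulVec_mulVec, Matrix.dotProduct_mulVec, ← Matrix.mulVec_transpose,
      transpose_inverseMetricRoot]
    simp [dotProduct, sq]
  rw [star_trivial, Matrix.sub_mulVec, dotProduct_sub, Matrix.one_mulVec, hPv, hv] at hnonneg
  exact sub_nonneg.1 hnonneg

theorem sum_norm_metricFrame_sub_sq_le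
    {A B : EuclideanSpace ℝ (Fin m) →L[ℝ] EuclideanSpace ℝ (Fin n)}
    (hA : ‖A‖ ^ 2 ≤ 1 / 2) (hB : ‖B‖ ^ 2 ≤ 1 / 2) :
    ∑ k, ‖metricFrame A k - metricFrame B k‖ ^ 2
      ≤ ∑ k, ‖A (metricFrame A k) - B (metricFrame B k)‖ ^ 2 := by
  simp only [map_metricFrame]
  simp only [metricFrame, sum_norm_toLp_col_sub_sq]
  exact trace_transpose_mul_self_sub_le (inverseMetricRoot_nonneg A) (inverseMetricRoot_nonneg B)
    (inverseMetricRoot_mul_self_eq_one_add (lt_one_of_sq_le_half hA))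
    (inverseMetricRoot_mul_self_eq_one_add (lt_one_of_sq_le_half hB))
    (transpose_mul_self_jacobianMatrix_mul_inverseMetricRoot_le hA)
    (transpose_mul_self_jacobianMatrix_mul_inverseMetricRoot_le hB)

end Frame

section Calculus

theorem second_deriv_nonpos_of_isLocalMax {h h' : ℝ → ℝ} {c x : ℝ} (hmax : IsLocalMax h x)
    (hh : ∀ᶠ s in 𝓝 x, HasDerivAt h (h' s) s) (hh' : HasDerivAt h' c x) : c ≤ 0 := by
  by_contra! hc
  have deriv_eq : deriv h =ᶠ[𝓝 x] h' := hh.mono fun s hs => hs.deriv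
  have deriv2_eq : deriv (deriv h) x = c := deriv_eq.deriv_eq.trans hh'.deriv
  have hmin : IsLocalMin h x := isLocalMin_of_deriv_deriv_pos (deriv2_eq ▸ hc)
    hmax.deriv_eq_zero hh.self_of_nhds.continuousAt
  have hconst : h =ᶠ[𝓝 x] fun _ => h x := by
    filter_upwards [hmax, hmin] with s hs1 hs2 using le_antisymm hs1 hs2
  have : deriv (deriv h) x = 0 := by rw [hconst.deriv.deriv_eq]; simp
  exact hc.ne (this.symm.trans deriv2_eq)

-- Subtracting `σ t` with a small `σ > 0` makes the time derivative strictly negative at the maximum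
-- over `K × [0, τ]`, where it has to be nonnegative.
theorem nonpos_of_deriv_nonpos_at_max {X : Type*} [TopologicalSpace X] {K : Set X}
    (hK : IsCompact K) {f : X → ℝ → ℝ} {τ : ℝ}
    (hf : ContinuousOn (fun p : X × ℝ => f p.1 p.2) (K ×ˢ Icc 0 τ)) (h0 : ∀ x ∈ K, f x 0 ≤ 0)
    (hmax : ∀ x ∈ K, ∀ t ∈ Ioc 0 τ, 0 < f x t → IsMaxOn (f · t) K x →
      ∃ c ≤ 0, HasDerivWithinAt (f x) c (Iic t) t) :
    ∀ x ∈ K, ∀ t ∈ Icc 0 τ, f x t ≤ 0 := by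
  intro a ha r hr
  by_contra! hpos
  have hr0 : 0 < r := hr.1.lt_of_ne' fun h => (h ▸ hpos).not_ge (h0 a ha)
  set σ := f a r / (2 * r) with hσ
  have hσ0 : 0 < σ := by positivity
  have hσr : σ * r = f a r / 2 := by rw [hσ]; field_simp
  obtain ⟨⟨x, t⟩, ⟨hx, ht⟩, hxt⟩ := (hK.prod isCompact_Icc).exists_isMaxOn ⟨(a, r), ha, hr⟩
    (hf.sub (f := fun p : X × ℝ => f p.1 p.2) (g := fun p => σ * p.2) (by fun_prop))
  have le_max {y s} (hy : y ∈ K) (hs : s ∈ Icc 0 τ) : f y s - σ * s ≤ f x t - σ * t :=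
    hxt (a := (y, s)) ⟨hy, hs⟩
  have hfxt : 0 < f x t := by nlinarith [le_max ha hr, ht.1]
  have ht0 : 0 < t := ht.1.lt_of_ne fun h => by subst h; exact hfxt.not_ge (h0 x hx)
  obtain ⟨c, hc, hderiv⟩ := hmax x hx t ⟨ht0, ht.2⟩ hfxt fun y hy => by
    have := le_max hy ht
    simpa using this
  have hd : HasDerivWithinAt (fun s => f x s - σ * s) (c - σ) (Icc 0 t) t := by
    simpa using (hderiv.mono Icc_subset_Iic_self).fun_sub
      (((hasDerivAt_id t).const_mul σ).hasDerivWithinAt)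
  have htime : IsMaxOn (fun s => f x s - σ * s) (Icc 0 t) t :=
    fun s hs => le_max hx ⟨hs.1, hs.2.trans ht.2⟩
  have hdir : 0 - t ∈ posTangentConeAt (Icc 0 t) t :=
    mem_posTangentConeAt_of_segment_subset
      (by rw [add_sub_cancel, segment_symm, segment_eq_Icc ht.1])
  have htc : 0 ≤ t * (c - σ) := by
    simpa using htime.localize.hasFDerivWithinAt_nonpos hd.hasFDerivWithinAt hdir
  nlinarith

variable {E F : Type*} [NormedAddCommGroup E] [NormedAddCommGroup F]

section Line

variable [NormedSpace ℝ E] [NormedSpace ℝ F] {f g : E → F} {x : E}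

theorem hasDerivAt_add_smul (x ξ : E) (s : ℝ) : HasDerivAt (fun s : ℝ => x + s • ξ) ξ s := by
  simpa using ((hasDerivAt_id s).smul_const ξ).const_add x

theorem tendsto_add_smul (x ξ : E) : Filter.Tendsto (fun s : ℝ => x + s • ξ) (𝓝 0) (𝓝 x) := by
  simpa using (hasDerivAt_add_smul x ξ 0).continuousAt.tendsto

theorem eventually_hasDerivAt_line (hf : ContDiffAt ℝ 2 f x) (ξ : E) :
    ∀ᶠ s : ℝ in 𝓝 0, HasDerivAt (fun s : ℝ => f (x + s • ξ)) (fderiv ℝ f (x + s • ξ) ξ) s := by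
  filter_upwards [(tendsto_add_smul x ξ).eventually (hf.eventually (by simp))] with s hs
  exact (hs.differentiableAt two_ne_zero).hasFDerivAt.comp_hasDerivAt s (hasDerivAt_add_smul x ξ s)

theorem differentiableAt_fderiv (hf : ContDiffAt ℝ 2 f x) : DifferentiableAt ℝ (fderiv ℝ f) x :=
  (hf.fderiv_right (m := 1) (by norm_num)).differentiableAt one_ne_zero

theorem hasDerivAt_fderiv_line (hf : ContDiffAt ℝ 2 f x) (ξ : E) :
    HasDerivAt (fun s : ℝ => fderiv ℝ f (x + s • ξ) ξ) (fderiv ℝ (fderiv ℝ f) x ξ ξ) 0 := by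
  have h : HasFDerivAt (fderiv ℝ f) (fderiv ℝ (fderiv ℝ f) x) (x + (0 : ℝ) • ξ) := by
    rw [zero_smul, add_zero]
    exact (differentiableAt_fderiv hf).hasFDerivAt
  have hline := h.comp_hasDerivAt 0 (hasDerivAt_add_smul x ξ 0)
  exact (hline.clm_apply (hasDerivAt_const 0 ξ)).congr_deriv (by simp)

theorem fderiv_fderiv_sub (hf : ContDiffAt ℝ 2 f x) (hg : ContDiffAt ℝ 2 g x) :
    fderiv ℝ (fderiv ℝ fun y => f y - g y) x
      = fderiv ℝ (fderiv ℝ f) x - fderiv ℝ (fderiv ℝ g) x := by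
  have h : fderiv ℝ (fun y => f y - g y) =ᶠ[𝓝 x] fun y => fderiv ℝ f y - fderiv ℝ g y := by
    filter_upwards [hf.eventually (by simp), hg.eventually (by simp)] with y hfy hgy
    exact fderiv_fun_sub (hfy.differentiableAt two_ne_zero) (hgy.differentiableAt two_ne_zero)
  rw [h.fderiv_eq, fderiv_fun_sub (differentiableAt_fderiv hf) (differentiableAt_fderiv hg)]

end Line

variable [InnerProductSpace ℝ E] [InnerProductSpace ℝ F] {f : E → F} {x y : E}

theorem inner_fderiv_fderiv_sub_add_norm_sq_le_of_isLocalMax (hfx : ContDiffAt ℝ 2 f x)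
    (hfy : ContDiffAt ℝ 2 f y) {c : ℝ}
    (hmax : IsLocalMax (fun z : E × E => ‖f z.1 - f z.2‖ ^ 2 - c * ‖z.1 - z.2‖ ^ 2) (x, y))
    (ξ η : E) :
    inner ℝ (f x - f y) (fderiv ℝ (fderiv ℝ f) x ξ ξ - fderiv ℝ (fderiv ℝ f) y η η)
      + ‖fderiv ℝ f x ξ - fderiv ℝ f y η‖ ^ 2 ≤ c * ‖ξ - η‖ ^ 2 := by
  set p : ℝ → F := fun s => f (x + s • ξ) - f (y + s • η) with hp
  set p' : ℝ → F := fun s => fderiv ℝ f (x + s • ξ) ξ - fderiv ℝ f (y + s • η) η with hp'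
  set q : ℝ → E := fun s => (x + s • ξ) - (y + s • η) with hq
  have dp : ∀ᶠ s in 𝓝 0, HasDerivAt p (p' s) s := by
    filter_upwards [eventually_hasDerivAt_line hfx ξ, eventually_hasDerivAt_line hfy η]
      with s hξ hη using hξ.sub hη
  have dp' := (hasDerivAt_fderiv_line hfx ξ).fun_sub (hasDerivAt_fderiv_line hfy η)
  have dq (s : ℝ) : HasDerivAt q (ξ - η) s :=
    (hasDerivAt_add_smul x ξ s).sub (hasDerivAt_add_smul y η s)
  have hloc : IsLocalMax (fun s => ‖p s‖ ^ 2 - c * ‖q s‖ ^ 2) 0 := by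
    filter_upwards [((tendsto_add_smul x ξ).prodMk_nhds (tendsto_add_smul y η)).eventually hmax]
      with s hs
    simpa [hp, hq] using hs
  have hderiv : ∀ᶠ s in 𝓝 0, HasDerivAt (fun s => ‖p s‖ ^ 2 - c * ‖q s‖ ^ 2)
      (2 * inner ℝ (p s) (p' s) - c * (2 * inner ℝ (q s) (ξ - η))) s := by
    filter_upwards [dp] with s hs using hs.norm_sq.sub ((dq s).norm_sq.const_mul c)
  have hderiv2 := ((dp.self_of_nhds.inner ℝ dp').const_mul 2).sub
    ((((dq 0).inner ℝ (hasDerivAt_const 0 (ξ - η))).const_mul 2).const_mul c)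
  have h := second_deriv_nonpos_of_isLocalMax hloc hderiv hderiv2
  simp only [hp, hp', zero_smul, add_zero, inner_zero_right, zero_add,
    real_inner_self_eq_norm_sq] at h
  linarith

theorem inner_fderiv_fderiv_le_of_isLocalMax_sub_barrier (hf : ContDiffAt ℝ 2 f x) {w : F}
    {ν x₀ : E} {K c : ℝ} (hmax : IsLocalMax (fun y => inner ℝ w (f y)
      - K * (inner ℝ ν (y - x₀) * (c - inner ℝ ν (y - x₀)))) x) (ξ : E) :
    inner ℝ w (fderiv ℝ (fderiv ℝ f) x ξ ξ) ≤ -(2 * K * inner ℝ ν ξ ^ 2) := by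
  set ℓ : ℝ → ℝ := fun s => inner ℝ ν (x + s • ξ - x₀)
  have dℓ (s : ℝ) : HasDerivAt ℓ (inner ℝ ν ξ) s := by
    simpa using (hasDerivAt_const s ν).inner ℝ ((hasDerivAt_add_smul x ξ s).sub_const x₀)
  have hloc : IsLocalMax (fun s => inner ℝ w (f (x + s • ξ)) - K * (ℓ s * (c - ℓ s))) 0 := by
    filter_upwards [(tendsto_add_smul x ξ).eventually hmax] with s hs
    simpa [ℓ] using hs
  have hderiv : ∀ᶠ s in 𝓝 0, HasDerivAt (fun s => inner ℝ w (f (x + s • ξ)) - K * (ℓ s * (c - ℓ s)))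
      (inner ℝ w (fderiv ℝ f (x + s • ξ) ξ) - K * (inner ℝ ν ξ * (c - 2 * ℓ s))) s := by
    filter_upwards [eventually_hasDerivAt_line hf ξ] with s hs
    refine (((hasDerivAt_const s w).inner ℝ hs).sub
      (((dℓ s).mul ((dℓ s).const_sub c)).const_mul K)).congr_deriv ?_
    rw [inner_zero_left, add_zero]
    ring
  have hderiv2 := ((hasDerivAt_const 0 w).inner ℝ (hasDerivAt_fderiv_line hf ξ)).sub
    (((((dℓ 0).const_mul 2).const_sub c).const_mul (inner ℝ ν ξ)).const_mul K)
  have h := second_deriv_nonpos_of_isLocalMax hloc hderiv hderiv2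
  rw [inner_zero_left, add_zero] at h
  linarith

end Calculus

section Flow

variable {m n : ℕ} {Ω : Set (EuclideanSpace ℝ (Fin m))} {T τ t : ℝ}
  {x y : EuclideanSpace ℝ (Fin m)}
  {u : EuclideanSpace ℝ (Fin m) → ℝ → EuclideanSpace ℝ (Fin n)}

/-- The graphic mean curvature flow system under the regularity which the gradient estimate uses:
`C²` in space and differentiable in time inside, `C¹` up to the boundary. Spacelikeness is not part
of it, so `(gⁱʲ)` may be the junk inverse `0`, but not where `|Du| < 1`. -/
structure IsGraphicMCF (Ω : Set (EuclideanSpace ℝ (Fin m))) (T : ℝ)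
    (u : EuclideanSpace ℝ (Fin m) → ℝ → EuclideanSpace ℝ (Fin n)) : Prop where
  contDiffOn_space : ∀ t ∈ Ioo 0 T, ContDiffOn ℝ 2 (fun x => u x t) Ω
  differentiableAt_time : ∀ x ∈ Ω, ∀ t ∈ Ioo 0 T, DifferentiableAt ℝ (fun s => u x s) t
  c1_closure : ContDiffOn ℝ 1 (fun p : EuclideanSpace ℝ (Fin m) × ℝ => u p.1 p.2)
    (closedCylinder Ω T)
  flow : ∀ x ∈ Ω, ∀ t ∈ Ioo 0 T,
    timeDeriv T u x t = ∑ i, ∑ j, (inducedMetric (spaceDeriv Ω u x t))⁻¹ i j •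
      spaceDeriv2 Ω u x t (EuclideanSpace.single i (1 : ℝ)) (EuclideanSpace.single j (1 : ℝ))

theorem IsSpacelikeGraphicMCF.isGraphicMCF (hu : IsSpacelikeGraphicMCF Ω T u) :
    IsGraphicMCF Ω T u where
  contDiffOn_space t ht := contDiffOn_infty.1
    (hu.smooth.comp (f := fun y => (y, t)) (by fun_prop) fun _ hy => ⟨hy, ht⟩) 2
  differentiableAt_time x hx t ht :=
    ((hu.smooth.comp (f := fun s => (x, s)) (by fun_prop) fun _ hs => ⟨hx, hs⟩).contDiffAt
      (Ioo_mem_nhds ht.1 ht.2)).differentiableAt (by simp)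
  c1_closure := hu.c1_closure
  flow := hu.flow

theorem spaceDeriv_eq_fderiv (hΩ : IsOpen Ω) (hx : x ∈ Ω) :
    spaceDeriv Ω u x t = fderiv ℝ (fun y => u y t) x :=
  fderivWithin_of_mem_nhds (Filter.mem_of_superset (hΩ.mem_nhds hx) subset_closure)

theorem spaceDeriv2_eq_fderiv_fderiv (hΩ : IsOpen Ω) (hx : x ∈ Ω) :
    spaceDeriv2 Ω u x t = fderiv ℝ (fderiv ℝ fun y => u y t) x := by
  have h : (fun y => spaceDeriv Ω u y t) =ᶠ[𝓝 x] fderiv ℝ fun y => u y t := by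
    filter_upwards [hΩ.mem_nhds hx] with y hy using spaceDeriv_eq_fderiv hΩ hy
  rw [spaceDeriv2, fderivWithin_of_mem_nhds (Filter.mem_of_superset (hΩ.mem_nhds hx)
    subset_closure), h.fderiv_eq]

theorem hasDerivAt_timeDeriv (ht : t ∈ Ioo 0 T)
    (hu : DifferentiableWithinAt ℝ (fun s => u x s) (Icc 0 T) t) :
    HasDerivAt (fun s => u x s) (timeDeriv T u x t) t :=
  hu.hasDerivWithinAt.hasDerivAt (Icc_mem_nhds ht.1 ht.2)

theorem IsGraphicMCF.hasDerivAt_time (hu : IsGraphicMCF Ω T u) (hx : x ∈ Ω) (ht : t ∈ Ioo 0 T) :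
    HasDerivAt (fun s => u x s) (timeDeriv T u x t) t :=
  hasDerivAt_timeDeriv ht (hu.differentiableAt_time x hx t ht).differentiableWithinAt

theorem IsGraphicMCF.contDiffAt_space (hu : IsGraphicMCF Ω T u) (hΩ : IsOpen Ω) (hx : x ∈ Ω)
    (ht : t ∈ Ioo 0 T) : ContDiffAt ℝ 2 (fun y => u y t) x :=
  (hu.contDiffOn_space t ht).contDiffAt (hΩ.mem_nhds hx)

theorem IsGraphicMCF.timeDeriv_eq_sum (hu : IsGraphicMCF Ω T u) (hΩ : IsOpen Ω) (hx : x ∈ Ω)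
    (ht : t ∈ Ioo 0 T) (hD : ‖spaceDeriv Ω u x t‖ < 1) :
    timeDeriv T u x t = ∑ k, fderiv ℝ (fderiv ℝ fun y => u y t) x
      (metricFrame (spaceDeriv Ω u x t) k) (metricFrame (spaceDeriv Ω u x t) k) := by
  rw [hu.flow x hx t ht, sum_inv_inducedMetric_smul hD, spaceDeriv2_eq_fderiv_fderiv hΩ hx]

theorem inner_timeDeriv_sub_nonpos_of_isLocalMax (hu : IsGraphicMCF Ω T u) (hΩ : IsOpen Ω)
    (hx : x ∈ Ω) (hy : y ∈ Ω) (ht : t ∈ Ioo 0 T) (hDx : ‖spaceDeriv Ω u x t‖ ^ 2 ≤ 1 / 2)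
    (hDy : ‖spaceDeriv Ω u y t‖ ^ 2 ≤ 1 / 2) {c : ℝ} (hc : c ≤ 1)
    (hmax : IsLocalMax (fun z : EuclideanSpace ℝ (Fin m) × EuclideanSpace ℝ (Fin m) =>
      ‖u z.1 t - u z.2 t‖ ^ 2 - c * ‖z.1 - z.2‖ ^ 2) (x, y)) :
    inner ℝ (u x t - u y t) (timeDeriv T u x t - timeDeriv T u y t) ≤ 0 := by
  have hsum := Finset.sum_le_sum fun k (_ : k ∈ Finset.univ) =>
    inner_fderiv_fderiv_sub_add_norm_sq_le_of_isLocalMax (hu.contDiffAt_space hΩ hx ht)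
      (hu.contDiffAt_space hΩ hy ht) hmax (metricFrame (spaceDeriv Ω u x t) k)
      (metricFrame (spaceDeriv Ω u y t) k)
  have hcoupling : c * ∑ k, ‖metricFrame (spaceDeriv Ω u x t) k
        - metricFrame (spaceDeriv Ω u y t) k‖ ^ 2
      ≤ ∑ k, ‖spaceDeriv Ω u x t (metricFrame (spaceDeriv Ω u x t) k)
        - spaceDeriv Ω u y t (metricFrame (spaceDeriv Ω u y t) k)‖ ^ 2 :=
    (mul_le_of_le_one_left (by positivity) hc).trans (sum_norm_metricFrame_sub_sq_le hDx hDy)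
  rw [Finset.sum_add_distrib, ← inner_sum, Finset.sum_sub_distrib, ← Finset.mul_sum,
    ← hu.timeDeriv_eq_sum hΩ hx ht (lt_one_of_sq_le_half hDx),
    ← hu.timeDeriv_eq_sum hΩ hy ht (lt_one_of_sq_le_half hDy),
    ← spaceDeriv_eq_fderiv hΩ hx, ← spaceDeriv_eq_fderiv hΩ hy] at hsum
  linarith

theorem continuousOn_doubled_difference
    (hu : ContinuousOn (fun p : EuclideanSpace ℝ (Fin m) × ℝ => u p.1 p.2) (closedCylinder Ω T))
    (hτ : τ ≤ T) :
    ContinuousOn (fun p : (EuclideanSpace ℝ (Fin m) × EuclideanSpace ℝ (Fin m)) × ℝ =>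
      u p.1.1 p.2 - u p.1.2 p.2) ((closure Ω ×ˢ closure Ω) ×ˢ Icc 0 τ) := by
  have hfst : ContinuousOn
      (fun p : (EuclideanSpace ℝ (Fin m) × EuclideanSpace ℝ (Fin m)) × ℝ => u p.1.1 p.2)
      ((closure Ω ×ˢ closure Ω) ×ˢ Icc 0 τ) :=
    hu.comp (f := fun p : (EuclideanSpace ℝ (Fin m) × EuclideanSpace ℝ (Fin m)) × ℝ =>
      (p.1.1, p.2)) (by fun_prop) fun p hp => ⟨hp.1.1, hp.2.1, hp.2.2.trans hτ⟩
  have hsnd : ContinuousOn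
      (fun p : (EuclideanSpace ℝ (Fin m) × EuclideanSpace ℝ (Fin m)) × ℝ => u p.1.2 p.2)
      ((closure Ω ×ˢ closure Ω) ×ˢ Icc 0 τ) :=
    hu.comp (f := fun p : (EuclideanSpace ℝ (Fin m) × EuclideanSpace ℝ (Fin m)) × ℝ =>
      (p.1.2, p.2)) (by fun_prop) fun p hp => ⟨hp.1.2, hp.2.1, hp.2.2.trans hτ⟩
  exact hfst.sub hsnd

theorem norm_sub_le_of_norm_sub_le_parabolic_boundary (hu : IsGraphicMCF Ω T u) (hΩ : IsOpen Ω)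
    (hbdd : Bornology.IsBounded Ω) (hτ : τ < T)
    (hD : ∀ x ∈ Ω, ∀ t ∈ Icc 0 τ, ‖spaceDeriv Ω u x t‖ ^ 2 ≤ 1 / 2) {L : ℝ} (hL0 : 0 ≤ L)
    (hL : L ≤ 1)
    (hlat : ∀ x ∈ frontier Ω, ∀ y ∈ closure Ω, ∀ t ∈ Icc 0 τ, ‖u y t - u x t‖ ≤ L * ‖y - x‖)
    (hinit : ∀ x ∈ closure Ω, ∀ y ∈ closure Ω, ‖u x 0 - u y 0‖ ≤ L * ‖x - y‖) :
    ∀ x ∈ closure Ω, ∀ y ∈ closure Ω, ∀ t ∈ Icc 0 τ, ‖u x t - u y t‖ ≤ L * ‖x - y‖ := by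
  set Z : EuclideanSpace ℝ (Fin m) × EuclideanSpace ℝ (Fin m) → ℝ → ℝ := fun z t =>
    ‖u z.1 t - u z.2 t‖ ^ 2 - L ^ 2 * ‖z.1 - z.2‖ ^ 2 with hZ
  have hZ_iff {x y t} : Z (x, y) t ≤ 0 ↔ ‖u x t - u y t‖ ≤ L * ‖x - y‖ := by
    rw [← pow_le_pow_iff_left₀ (norm_nonneg _) (by positivity) two_ne_zero, mul_pow, hZ, sub_nonpos]
  have hcomp : IsCompact (closure Ω) := hbdd.isCompact_closure
  have hcont : ContinuousOn (fun p : (EuclideanSpace ℝ (Fin m) × EuclideanSpace ℝ (Fin m)) × ℝ =>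
      Z p.1 p.2) ((closure Ω ×ˢ closure Ω) ×ˢ Icc 0 τ) :=
    ((continuousOn_doubled_difference hu.c1_closure.continuousOn hτ.le).norm.pow 2).sub
      (by fun_prop)
  have hmax : ∀ z ∈ closure Ω ×ˢ closure Ω, ∀ t ∈ Ioc 0 τ, 0 < Z z t →
      IsMaxOn (Z · t) (closure Ω ×ˢ closure Ω) z →
      ∃ c ≤ 0, HasDerivWithinAt (Z z) c (Iic t) t := by
    rintro ⟨x, y⟩ ⟨hx, hy⟩ t ht hpos hmax
    have htI : t ∈ Icc 0 τ := Ioc_subset_Icc_self ht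
    have htT : t ∈ Ioo 0 T := ⟨ht.1, ht.2.trans_lt hτ⟩
    have hxΩ : x ∈ Ω := by
      refine (closure_eq_self_union_frontier Ω ▸ hx).resolve_right fun hxf => hpos.not_ge ?_
      rw [hZ_iff, norm_sub_rev, norm_sub_rev x]
      exact hlat x hxf y hy t htI
    have hyΩ : y ∈ Ω := (closure_eq_self_union_frontier Ω ▸ hy).resolve_right fun hyf =>
      hpos.not_ge (hZ_iff.2 (hlat y hyf x hx t htI))
    have hnonpos := inner_timeDeriv_sub_nonpos_of_isLocalMax hu hΩ hxΩ hyΩ htT (hD x hxΩ t htI)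
      (hD y hyΩ t htI) (pow_le_one₀ hL0 hL) (hmax.isLocalMax (prod_mem_nhds
        (Filter.mem_of_superset (hΩ.mem_nhds hxΩ) subset_closure)
        (Filter.mem_of_superset (hΩ.mem_nhds hyΩ) subset_closure)))
    exact ⟨_, mul_nonpos_of_nonneg_of_nonpos zero_le_two hnonpos,
      (((hu.hasDerivAt_time hxΩ htT).sub
        (hu.hasDerivAt_time hyΩ htT)).norm_sq.sub_const _).hasDerivWithinAt⟩
  intro x hx y hy t ht
  exact hZ_iff.1 (nonpos_of_deriv_nonpos_at_max (hcomp.prod hcomp) hcont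
    (fun z hz => hZ_iff.2 (hinit z.1 hz.1 z.2 hz.2)) hmax (x, y) ⟨hx, hy⟩ t ht)

end Flow

section Barrier

theorem exists_inward_unit_normal {E : Type*} [NormedAddCommGroup E] [InnerProductSpace ℝ E]
    [CompleteSpace E] {Ω : Set E} (hΩ : IsOpen Ω) (hconv : Convex ℝ Ω) {x₀ : E}
    (hx₀ : x₀ ∈ frontier Ω) :
    ∃ ν : E, ‖ν‖ = 1 ∧ ∀ y ∈ closure Ω, 0 ≤ inner ℝ ν (y - x₀) := by
  rw [hΩ.frontier_eq] at hx₀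
  obtain ⟨f, hf⟩ := geometric_hahn_banach_point_open hconv hΩ hx₀.2
  set v := (InnerProductSpace.toDual ℝ E).symm f with hv
  have hpos : ∀ y ∈ Ω, 0 < inner ℝ v (y - x₀) := fun y hy => by
    rw [hv, InnerProductSpace.toDual_symm_apply, map_sub]
    exact sub_pos.2 (hf y hy)
  obtain ⟨y₀, hy₀⟩ := closure_nonempty_iff.1 ⟨x₀, hx₀.1⟩
  have hv0 : v ≠ 0 := fun h => by simpa [h] using hpos y₀ hy₀
  refine ⟨‖v‖⁻¹ • v, norm_smul_inv_norm hv0, fun y hy => ?_⟩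
  refine le_on_closure (f := fun _ => 0) (g := fun y => inner ℝ (‖v‖⁻¹ • v) (y - x₀))
    (fun z hz => ?_) continuousOn_const (by fun_prop) hy
  rw [real_inner_smul_left]
  exact mul_nonneg (inv_nonneg.2 (norm_nonneg v)) (hpos z hz).le

variable {m n : ℕ} {Ω : Set (EuclideanSpace ℝ (Fin m))} {T τ t ε d : ℝ}
  {x₀ ν : EuclideanSpace ℝ (Fin m)} {w : EuclideanSpace ℝ (Fin n)}
  {u φ : EuclideanSpace ℝ (Fin m) → ℝ → EuclideanSpace ℝ (Fin n)}

theorem inner_timeDeriv_le_of_isLocalMax_sub_barrier {x : EuclideanSpace ℝ (Fin m)} {K c : ℝ}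
    (hu : IsGraphicMCF Ω T u) (hΩ : IsOpen Ω) (hx : x ∈ Ω) (ht : t ∈ Ioo 0 T)
    (hD : ‖spaceDeriv Ω u x t‖ ^ 2 ≤ 1 / 2) (hφ : ContDiffAt ℝ 2 (fun y => φ y t) x)
    (hε : 0 ≤ ε) (hφ2 : ∀ v, ‖spaceDeriv2 Ω φ x t v v‖ ≤ ε * ‖v‖ ^ 2)
    (hK : 0 ≤ K) (hν : ‖ν‖ = 1) (hw : ‖w‖ ≤ 1)
    (hmax : IsLocalMax (fun y => inner ℝ w (u y t - φ y t)
      - K * (inner ℝ ν (y - x₀) * (c - inner ℝ ν (y - x₀)))) x) :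
    inner ℝ w (timeDeriv T u x t) ≤ 2 * m * ε - 2 * K := by
  have hux := hu.contDiffAt_space hΩ hx ht
  have hdirection (ξ : EuclideanSpace ℝ (Fin m)) :
      inner ℝ w (fderiv ℝ (fderiv ℝ fun y => u y t) x ξ ξ)
        ≤ ε * ‖ξ‖ ^ 2 - 2 * K * inner ℝ ν ξ ^ 2 := by
    have h := inner_fderiv_fderiv_le_of_isLocalMax_sub_barrier (hux.sub hφ) hmax ξ
    have hφξ : inner ℝ w (spaceDeriv2 Ω φ x t ξ ξ) ≤ ε * ‖ξ‖ ^ 2 :=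
      (real_inner_le_norm _ _).trans
        ((mul_le_of_le_one_left (norm_nonneg _) hw).trans (hφ2 ξ))
    rw [fderiv_fderiv_sub hux hφ, ← spaceDeriv2_eq_fderiv_fderiv (u := φ) hΩ hx, sub_apply,
      sub_apply, inner_sub_right] at h
    linarith
  have hsum := Finset.sum_le_sum fun k (_ : k ∈ Finset.univ) =>
    hdirection (metricFrame (spaceDeriv Ω u x t) k)
  rw [← inner_sum, Finset.sum_sub_distrib, ← Finset.mul_sum, ← Finset.mul_sum,
    ← hu.timeDeriv_eq_sum hΩ hx ht (lt_one_of_sq_le_half hD)] at hsum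
  have hupper := mul_le_mul_of_nonneg_left (sum_norm_metricFrame_sq_le hD) hε
  have hlower := mul_le_mul_of_nonneg_left
    (norm_sq_le_sum_inner_metricFrame_sq (lt_one_of_sq_le_half hD) ν) (mul_nonneg zero_le_two hK)
  rw [hν] at hlower
  linarith

theorem inner_sub_le_barrier (hu : IsGraphicMCF Ω T u) (hφ : IsParabolicC2 Ω T φ)
    (hΩ : IsOpen Ω) (hbdd : Bornology.IsBounded Ω)
    (hbdry : ∀ x ∈ frontier Ω, ∀ t ∈ Icc 0 T, u x t = φ x t)
    (hinit : ∀ x ∈ closure Ω, u x 0 = φ x 0) (hτ : τ < T)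
    (hD : ∀ x ∈ Ω, ∀ t ∈ Icc 0 τ, ‖spaceDeriv Ω u x t‖ ^ 2 ≤ 1 / 2) (hε : 0 ≤ ε)
    (hφ2 : ∀ x ∈ closure Ω, ∀ t ∈ Icc 0 T, ∀ v, ‖spaceDeriv2 Ω φ x t v v‖ ≤ ε * ‖v‖ ^ 2)
    (hφt : ∀ x ∈ closure Ω, ∀ t ∈ Icc 0 T, ‖timeDeriv T φ x t‖ ≤ ε)
    (hν : ‖ν‖ = 1) (hw : ‖w‖ ≤ 1) {c : ℝ}
    (hbarrier : ∀ y ∈ closure Ω, 0 ≤ inner ℝ ν (y - x₀) * (c - inner ℝ ν (y - x₀))) :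
    ∀ y ∈ closure Ω, ∀ t ∈ Icc 0 τ, inner ℝ w (u y t - φ y t)
      ≤ (m + 1 / 2) * ε * (inner ℝ ν (y - x₀) * (c - inner ℝ ν (y - x₀))) := by
  have hK : 0 ≤ (m + 1 / 2) * ε := by positivity
  have hsub : closure Ω ×ˢ Icc 0 τ ⊆ closedCylinder Ω T :=
    prod_mono_right (Icc_subset_Icc_right hτ.le)
  set f : EuclideanSpace ℝ (Fin m) → ℝ → ℝ := fun y t => inner ℝ w (u y t - φ y t)
    - (m + 1 / 2) * ε * (inner ℝ ν (y - x₀) * (c - inner ℝ ν (y - x₀))) with hf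
  have hf_nonpos {y t} (hy : y ∈ closure Ω) (h : u y t = φ y t) : f y t ≤ 0 := by
    simpa [hf, h] using mul_nonneg hK (hbarrier y hy)
  have hcont : ContinuousOn (fun p : EuclideanSpace ℝ (Fin m) × ℝ => f p.1 p.2)
      (closure Ω ×ˢ Icc 0 τ) :=
    (continuousOn_const.inner ((hu.c1_closure.continuousOn.mono hsub).sub
      (hφ.continuous.mono hsub))).sub (by fun_prop)
  have hmax : ∀ x ∈ closure Ω, ∀ t ∈ Ioc 0 τ, 0 < f x t → IsMaxOn (f · t) (closure Ω) x →
      ∃ c ≤ 0, HasDerivWithinAt (f x) c (Iic t) t := by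
    intro x hx t ht hpos hmax
    have htT : t ∈ Ioo 0 T := ⟨ht.1, ht.2.trans_lt hτ⟩
    have htI : t ∈ Icc 0 T := Ioo_subset_Icc_self htT
    have hxΩ : x ∈ Ω := (closure_eq_self_union_frontier Ω ▸ hx).resolve_right fun hxf =>
      hpos.not_ge (hf_nonpos hx (hbdry x hxf t htI))
    have hnhds : closure Ω ∈ 𝓝 x := Filter.mem_of_superset (hΩ.mem_nhds hxΩ) subset_closure
    have hspace := inner_timeDeriv_le_of_isLocalMax_sub_barrier hu hΩ hxΩ htT
      (hD x hxΩ t (Ioc_subset_Icc_self ht)) ((hφ.contDiff_space t htI).contDiffAt hnhds) hε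
      (hφ2 x hx t htI) hK hν hw (hmax.isLocalMax hnhds)
    have htime : -inner ℝ w (timeDeriv T φ x t) ≤ ε :=
      (neg_le_abs _).trans ((abs_real_inner_le_norm _ _).trans
        ((mul_le_of_le_one_left (norm_nonneg _) hw).trans (hφt x hx t htI)))
    have hderiv := ((hasDerivAt_const t w).inner ℝ ((hu.hasDerivAt_time hxΩ htT).fun_sub
      (hasDerivAt_timeDeriv htT (hφ.differentiable_time x hx t htI)))).sub_const
      ((m + 1 / 2) * ε * (inner ℝ ν (x - x₀) * (c - inner ℝ ν (x - x₀))))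
    refine ⟨_, ?_, hderiv.hasDerivWithinAt⟩
    rw [inner_zero_left, add_zero, inner_sub_right]
    linarith
  exact fun y hy t ht => sub_nonpos.1 (nonpos_of_deriv_nonpos_at_max hbdd.isCompact_closure hcont
    (fun x hx => hf_nonpos hx (hinit x hx)) hmax y hy t ht)

theorem norm_sub_le_of_mem_frontier (hu : IsGraphicMCF Ω T u) (hφ : IsParabolicC2 Ω T φ)
    (hΩ : IsOpen Ω) (hconv : Convex ℝ Ω) (hbdd : Bornology.IsBounded Ω) (hd : Metric.diam Ω ≤ d)
    (hbdry : ∀ x ∈ frontier Ω, ∀ t ∈ Icc 0 T, u x t = φ x t)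
    (hinit : ∀ x ∈ closure Ω, u x 0 = φ x 0) (hτ : τ < T)
    (hD : ∀ x ∈ Ω, ∀ t ∈ Icc 0 τ, ‖spaceDeriv Ω u x t‖ ^ 2 ≤ 1 / 2) (hε : 0 ≤ ε)
    (hφ2 : ∀ x ∈ closure Ω, ∀ t ∈ Icc 0 T, ∀ v, ‖spaceDeriv2 Ω φ x t v v‖ ≤ ε * ‖v‖ ^ 2)
    (hφt : ∀ x ∈ closure Ω, ∀ t ∈ Icc 0 T, ‖timeDeriv T φ x t‖ ≤ ε)
    (hx₀ : x₀ ∈ frontier Ω) :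
    ∀ y ∈ closure Ω, ∀ t ∈ Icc 0 τ, ‖u y t - φ y t‖ ≤ (2 * m + 1) * d * ε * ‖y - x₀‖ := by
  obtain ⟨ν, hν, hν0⟩ := exists_inward_unit_normal hΩ hconv hx₀
  have hν_le (y : EuclideanSpace ℝ (Fin m)) : inner ℝ ν (y - x₀) ≤ ‖y - x₀‖ := by
    simpa [hν] using real_inner_le_norm ν (y - x₀)
  have hdist : ∀ y ∈ closure Ω, ‖y - x₀‖ ≤ d := fun y hy => by
    rw [← dist_eq_norm]
    exact (Metric.dist_le_diam_of_mem hbdd.closure hy (frontier_subset_closure hx₀)).trans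
      ((Metric.diam_closure Ω).trans_le hd)
  have hbarrier : ∀ y ∈ closure Ω,
      0 ≤ inner ℝ ν (y - x₀) * (2 * d - inner ℝ ν (y - x₀)) := fun y hy =>
    mul_nonneg (hν0 y hy) (by linarith [hν_le y, hdist y hy, norm_nonneg (y - x₀)])
  intro y hy t ht
  set p := u y t - φ y t
  have hw : ‖‖p‖⁻¹ • p‖ ≤ 1 := by
    simpa [norm_smul] using inv_mul_le_one
  have hpp : inner ℝ (‖p‖⁻¹ • p) p = ‖p‖ := by
    rw [real_inner_smul_left, real_inner_self_eq_norm_sq, sq, ← mul_assoc, inv_mul_mul_self]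
  calc ‖p‖ = inner ℝ (‖p‖⁻¹ • p) p := hpp.symm
    _ ≤ (m + 1 / 2) * ε * (inner ℝ ν (y - x₀) * (2 * d - inner ℝ ν (y - x₀))) :=
      inner_sub_le_barrier hu hφ hΩ hbdd hbdry hinit hτ hD hε hφ2 hφt hν hw hbarrier y hy t ht
    _ ≤ (m + 1 / 2) * ε * (‖y - x₀‖ * (2 * d)) := by
      gcongr
      · linarith [hν_le y, hdist y hy, hν0 y hy]
      · exact hν_le y
      · linarith [hν0 y hy]
    _ = (2 * m + 1) * d * ε * ‖y - x₀‖ := by ring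

end Barrier

section Norms

variable {m n : ℕ} {Ω : Set (EuclideanSpace ℝ (Fin m))} {T ε : ℝ}
  {φ : EuclideanSpace ℝ (Fin m) → ℝ → EuclideanSpace ℝ (Fin n)}

theorem tripleNorm_le (A : EuclideanSpace ℝ (Fin m) →L[ℝ] EuclideanSpace ℝ (Fin n)) :
    tripleNorm A ≤ ‖A‖ₑ := by
  refine iSup₂_le fun v hv => enorm_le_iff_norm_le.2 ?_
  simpa [mem_sphere_zero_iff_norm.1 hv] using A.le_opNorm v

theorem norm_le_of_tripleNorm_le (hε : 0 ≤ ε)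
    {A : EuclideanSpace ℝ (Fin m) →L[ℝ] EuclideanSpace ℝ (Fin n)}
    (h : tripleNorm A ≤ ENNReal.ofReal ε) : ‖A‖ ≤ ε := by
  refine A.opNorm_le_of_unit_norm hε fun v hv => ?_
  have hv' := iSup₂_le_iff.1 h v (mem_sphere_zero_iff_norm.2 hv)
  rwa [← ofReal_norm, ENNReal.ofReal_le_ofReal_iff hε] at hv'

theorem norm_apply_self_le_of_tripleNorm2_le (hε : 0 ≤ ε)
    {B : EuclideanSpace ℝ (Fin m) →L[ℝ] EuclideanSpace ℝ (Fin m) →L[ℝ] EuclideanSpace ℝ (Fin n)}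
    (h : tripleNorm2 B ≤ ENNReal.ofReal ε) (v : EuclideanSpace ℝ (Fin m)) :
    ‖B v v‖ ≤ ε * ‖v‖ ^ 2 := by
  rcases eq_or_ne v 0 with rfl | hv
  · simp
  have hpos : 0 < ‖v‖ := norm_pos_iff.2 hv
  have hunit := iSup₂_le_iff.1 h (‖v‖⁻¹ • v) (by simp [norm_smul, hpos.ne'])
  rw [← ofReal_norm, ENNReal.ofReal_le_ofReal_iff hε] at hunit
  simp only [map_smul, smul_apply, norm_smul, norm_inv, norm_norm] at hunit
  calc ‖B v v‖ = (‖v‖⁻¹ * (‖v‖⁻¹ * ‖B v v‖)) * ‖v‖ ^ 2 := by field_simp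
    _ ≤ ε * ‖v‖ ^ 2 := by gcongr

variable {x : EuclideanSpace ℝ (Fin m)} {t : ℝ}

theorem norm_spaceDeriv_le_of_parabolicC2Norm_le (hε : 0 ≤ ε)
    (h : parabolicC2Norm Ω T φ ≤ ENNReal.ofReal ε) (hx : x ∈ closure Ω) (ht : t ∈ Icc 0 T) :
    ‖spaceDeriv Ω φ x t‖ ≤ ε := by
  have hsup : ⨆ p ∈ closedCylinder Ω T, tripleNorm (spaceDeriv Ω φ p.1 p.2) ≤ ENNReal.ofReal ε :=
    (le_add_self.trans (le_self_add.trans le_self_add)).trans h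
  exact norm_le_of_tripleNorm_le hε (iSup₂_le_iff.1 hsup (x, t) ⟨hx, ht⟩)

theorem norm_spaceDeriv2_apply_self_le_of_parabolicC2Norm_le (hε : 0 ≤ ε)
    (h : parabolicC2Norm Ω T φ ≤ ENNReal.ofReal ε) (hx : x ∈ closure Ω) (ht : t ∈ Icc 0 T)
    (v : EuclideanSpace ℝ (Fin m)) : ‖spaceDeriv2 Ω φ x t v v‖ ≤ ε * ‖v‖ ^ 2 := by
  have hsup : ⨆ p ∈ closedCylinder Ω T, tripleNorm2 (spaceDeriv2 Ω φ p.1 p.2)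
      ≤ ENNReal.ofReal ε := (le_add_self.trans le_self_add).trans h
  exact norm_apply_self_le_of_tripleNorm2_le hε (iSup₂_le_iff.1 hsup (x, t) ⟨hx, ht⟩) v

theorem norm_timeDeriv_le_of_parabolicC2Norm_le (hε : 0 ≤ ε)
    (h : parabolicC2Norm Ω T φ ≤ ENNReal.ofReal ε) (hx : x ∈ closure Ω) (ht : t ∈ Icc 0 T) :
    ‖timeDeriv T φ x t‖ ≤ ε := by
  have hsup : ⨆ p ∈ closedCylinder Ω T, ‖timeDeriv T φ p.1 p.2‖ₑ ≤ ENNReal.ofReal ε :=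
    le_add_self.trans h
  have hxt := iSup₂_le_iff.1 hsup (x, t) ⟨hx, ht⟩
  rwa [← ofReal_norm, ENNReal.ofReal_le_ofReal_iff hε] at hxt

end Norms

section Gradient

theorem forall_lt_of_forall_lt_before {X : Type*} [TopologicalSpace X] {K : Set X}
    (hK : IsCompact K) {f : X → ℝ → ℝ} {b T : ℝ}
    (hf : ContinuousOn (fun p : X × ℝ => f p.1 p.2) (K ×ˢ Icc 0 T))
    (hstep : ∀ t ∈ Icc 0 T, (∀ s ∈ Ico 0 t, ∀ x ∈ K, f x s < b) → ∀ x ∈ K, f x t < b) :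
    ∀ t ∈ Icc 0 T, ∀ x ∈ K, f x t < b := by
  intro r hr a ha
  by_contra! hbad
  have hcompact : IsCompact {p ∈ K ×ˢ Icc 0 T | b ≤ f p.1 p.2} := by
    obtain ⟨F, hF, hFf⟩ := continuousOn_iff_isClosed.1 hf (Ici b) isClosed_Ici
    have : {p ∈ K ×ˢ Icc 0 T | b ≤ f p.1 p.2} = (K ×ˢ Icc 0 T) ∩ F := by
      rw [inter_comm, ← hFf, inter_comm]; rfl
    exact this ▸ (hK.prod isCompact_Icc).inter_right hF
  obtain ⟨⟨x, t⟩, ⟨⟨hx, ht⟩, hxt⟩, hfirst⟩ :=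
    hcompact.exists_isMinOn ⟨(a, r), ⟨ha, hr⟩, hbad⟩ continuous_snd.continuousOn
  refine (hstep t ht (fun s hs y hy => ?_) x hx).not_ge hxt
  by_contra! hys
  exact hs.2.not_ge (hfirst (a := (y, s)) ⟨⟨hy, hs.1, hs.2.le.trans ht.2⟩, hys⟩)

variable {m n : ℕ} {Ω : Set (EuclideanSpace ℝ (Fin m))} {T τ t ε d : ℝ}
  {u φ : EuclideanSpace ℝ (Fin m) → ℝ → EuclideanSpace ℝ (Fin n)}

theorem uniqueDiffOn_closure_of_isOpen_of_convex {E : Type*} [NormedAddCommGroup E]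
    [NormedSpace ℝ E] {s : Set E} (hs : IsOpen s) (hconv : Convex ℝ s) :
    UniqueDiffOn ℝ (closure s) := by
  rcases s.eq_empty_or_nonempty with rfl | hne
  · simpa using uniqueDiffOn_empty
  · exact uniqueDiffOn_convex hconv.closure (hne.mono (interior_maximal subset_closure hs))

theorem continuousOn_spaceDeriv (hT : 0 < T) (hΩ : UniqueDiffOn ℝ (closure Ω))
    (hu : ContDiffOn ℝ 1 (fun p : EuclideanSpace ℝ (Fin m) × ℝ => u p.1 p.2)
      (closedCylinder Ω T)) :
    ContinuousOn (fun p : EuclideanSpace ℝ (Fin m) × ℝ => spaceDeriv Ω u p.1 p.2)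
      (closedCylinder Ω T) := by
  have hcont := (hu.continuousOn_fderivWithin (hΩ.prod (uniqueDiffOn_Icc hT)) le_rfl).clm_comp
    (continuousOn_const (c := ContinuousLinearMap.inl ℝ (EuclideanSpace ℝ (Fin m)) ℝ))
  refine hcont.congr fun p hp => ?_
  have hslice : HasFDerivWithinAt (fun y => (y, p.2))
      (ContinuousLinearMap.inl ℝ (EuclideanSpace ℝ (Fin m)) ℝ) (closure Ω) p.1 :=
    (hasFDerivAt_prodMk_left p.1 p.2).hasFDerivWithinAt
  have hmaps : MapsTo (fun y => (y, p.2)) (closure Ω) (closedCylinder Ω T) :=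
    fun y hy => ⟨hy, hp.2⟩
  exact ((hu.differentiableOn one_ne_zero p hp).hasFDerivWithinAt.comp p.1 hslice
    hmaps).fderivWithin (hΩ p.1 hp.1)

theorem norm_spaceDeriv_le_of_forall_le (hΩ : IsOpen Ω) {L : ℝ} (hL : 0 ≤ L)
    (hu : ∀ x ∈ closure Ω, ∀ y ∈ closure Ω, ‖u x t - u y t‖ ≤ L * ‖x - y‖)
    {x : EuclideanSpace ℝ (Fin m)} (hx : x ∈ Ω) : ‖spaceDeriv Ω u x t‖ ≤ L := by
  rw [spaceDeriv_eq_fderiv hΩ hx]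
  refine norm_fderiv_le_of_lip' ℝ hL ?_
  filter_upwards [hΩ.mem_nhds hx] with y hy
  exact hu y (subset_closure hy) x (subset_closure hx)

theorem norm_sub_le_of_parabolicC2Norm_le (hφ : IsParabolicC2 Ω T φ) (hconv : Convex ℝ Ω)
    (hε : 0 ≤ ε) (hnorm : parabolicC2Norm Ω T φ ≤ ENNReal.ofReal ε) (ht : t ∈ Icc 0 T) :
    ∀ x ∈ closure Ω, ∀ y ∈ closure Ω, ‖φ x t - φ y t‖ ≤ ε * ‖x - y‖ := fun _ hx _ hy =>
  hconv.closure.norm_image_sub_le_of_norm_fderivWithin_le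
    ((hφ.contDiff_space t ht).differentiableOn two_ne_zero)
    (fun _ hz => norm_spaceDeriv_le_of_parabolicC2Norm_le hε hnorm hz ht) hy hx

theorem norm_spaceDeriv_le_of_sq_le_half (hu : IsGraphicMCF Ω T u) (hφ : IsParabolicC2 Ω T φ)
    (hΩ : IsOpen Ω) (hconv : Convex ℝ Ω) (hbdd : Bornology.IsBounded Ω) (hd : Metric.diam Ω ≤ d)
    (hbdry : ∀ x ∈ frontier Ω, ∀ t ∈ Icc 0 T, u x t = φ x t)
    (hinit : ∀ x ∈ closure Ω, u x 0 = φ x 0) (hε : 0 ≤ ε)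
    (hnorm : parabolicC2Norm Ω T φ ≤ ENNReal.ofReal ε) (hL : ((2 * m + 1) * d + 1) * ε ≤ 1)
    (hτ : τ ∈ Ico 0 T) (hD : ∀ x ∈ Ω, ∀ t ∈ Icc 0 τ, ‖spaceDeriv Ω u x t‖ ^ 2 ≤ 1 / 2) :
    ∀ x ∈ Ω, ∀ t ∈ Icc 0 τ, ‖spaceDeriv Ω u x t‖ ≤ ((2 * m + 1) * d + 1) * ε := by
  have hd0 : 0 ≤ d := Metric.diam_nonneg.trans hd
  have hlat : ∀ x ∈ frontier Ω, ∀ y ∈ closure Ω, ∀ t ∈ Icc 0 τ,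
      ‖u y t - u x t‖ ≤ ((2 * m + 1) * d + 1) * ε * ‖y - x‖ := by
    intro x hx y hy t ht
    have htT : t ∈ Icc 0 T := ⟨ht.1, ht.2.trans hτ.2.le⟩
    calc ‖u y t - u x t‖ ≤ ‖u y t - φ y t‖ + ‖φ y t - u x t‖ := norm_sub_le_norm_sub_add_norm_sub ..
      _ ≤ (2 * m + 1) * d * ε * ‖y - x‖ + ε * ‖y - x‖ := by
        refine add_le_add (norm_sub_le_of_mem_frontier hu hφ hΩ hconv hbdd hd hbdry hinit hτ.2 hD hε
          (fun x hx t ht => norm_spaceDeriv2_apply_self_le_of_parabolicC2Norm_le hε hnorm hx ht)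
          (fun x hx t ht => norm_timeDeriv_le_of_parabolicC2Norm_le hε hnorm hx ht) hx y hy t ht) ?_
        rw [hbdry x hx t htT]
        exact norm_sub_le_of_parabolicC2Norm_le hφ hconv hε hnorm htT y hy x
          (frontier_subset_closure hx)
      _ = ((2 * m + 1) * d + 1) * ε * ‖y - x‖ := by ring
  have hzero : ∀ x ∈ closure Ω, ∀ y ∈ closure Ω,
      ‖u x 0 - u y 0‖ ≤ ((2 * m + 1) * d + 1) * ε * ‖x - y‖ := by
    intro x hx y hy
    rw [hinit x hx, hinit y hy]
    refine (norm_sub_le_of_parabolicC2Norm_le hφ hconv hε hnorm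
      ⟨le_rfl, hτ.1.trans hτ.2.le⟩ x hx y hy).trans ?_
    gcongr
    exact le_mul_of_one_le_left hε (le_add_of_nonneg_left (by positivity))
  have hlip := norm_sub_le_of_norm_sub_le_parabolic_boundary hu hΩ hbdd hτ.2 hD (by positivity) hL
    hlat hzero
  exact fun x hx t ht => norm_spaceDeriv_le_of_forall_le hΩ (by positivity)
    (fun x hx y hy => hlip x hx y hy t ht) hx

theorem norm_spaceDeriv_le_of_forall_Ioo_le (hΩ : UniqueDiffOn ℝ (closure Ω))
    (hu : ContDiffOn ℝ 1 (fun p : EuclideanSpace ℝ (Fin m) × ℝ => u p.1 p.2) (closedCylinder Ω T))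
    (ht : t ∈ Ioc 0 T) {L : ℝ} (hD : ∀ x ∈ Ω, ∀ s ∈ Ioo 0 t, ‖spaceDeriv Ω u x s‖ ≤ L) :
    ∀ x ∈ closure Ω, ∀ s ∈ Icc 0 t, ‖spaceDeriv Ω u x s‖ ≤ L := by
  intro x hx s hs
  have hcl : closure (Ω ×ˢ Ioo 0 t) = closure Ω ×ˢ Icc 0 t := by
    rw [closure_prod_eq, closure_Ioo ht.1.ne]
  have hcont := (continuousOn_spaceDeriv (ht.1.trans_le ht.2) hΩ hu).norm
  exact le_on_closure (f := fun p : EuclideanSpace ℝ (Fin m) × ℝ => ‖spaceDeriv Ω u p.1 p.2‖)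
    (g := fun _ => L) (fun p hp => hD p.1 hp.1 p.2 hp.2)
    (hcont.mono (hcl ▸ prod_mono_right (Icc_subset_Icc_right ht.2))) continuousOn_const
    (x := (x, s)) (hcl ▸ ⟨hx, hs⟩)

theorem norm_spaceDeriv_le_of_forall_Ico_sq_le_half (hu : IsGraphicMCF Ω T u)
    (hφ : IsParabolicC2 Ω T φ) (hΩ : IsOpen Ω) (hconv : Convex ℝ Ω)
    (hbdd : Bornology.IsBounded Ω) (hd : Metric.diam Ω ≤ d)
    (hbdry : ∀ x ∈ frontier Ω, ∀ t ∈ Icc 0 T, u x t = φ x t)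
    (hinit : ∀ x ∈ closure Ω, u x 0 = φ x 0) (hε : 0 ≤ ε)
    (hnorm : parabolicC2Norm Ω T φ ≤ ENNReal.ofReal ε) (hL : ((2 * m + 1) * d + 1) * ε ≤ 1)
    (ht : t ∈ Ioc 0 T) (hD : ∀ s ∈ Ico 0 t, ∀ x ∈ closure Ω, ‖spaceDeriv Ω u x s‖ ^ 2 < 1 / 2) :
    ∀ x ∈ closure Ω, ∀ s ∈ Icc 0 t, ‖spaceDeriv Ω u x s‖ ≤ ((2 * m + 1) * d + 1) * ε :=
  norm_spaceDeriv_le_of_forall_Ioo_le (uniqueDiffOn_closure_of_isOpen_of_convex hΩ hconv)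
    hu.c1_closure ht fun x hx s hs => norm_spaceDeriv_le_of_sq_le_half hu hφ hΩ hconv hbdd hd hbdry
      hinit hε hnorm hL ⟨hs.1.le, hs.2.trans_le ht.2⟩
      (fun y hy r hr => (hD r ⟨hr.1, hr.2.trans_lt hs.2⟩ y (subset_closure hy)).le)
      x hx s ⟨hs.1.le, le_rfl⟩

theorem norm_spaceDeriv_le (hu : IsGraphicMCF Ω T u) (hφ : IsParabolicC2 Ω T φ) (hT : 0 < T)
    (hΩ : IsOpen Ω) (hconv : Convex ℝ Ω) (hbdd : Bornology.IsBounded Ω) (hd : Metric.diam Ω ≤ d)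
    (hbdry : ∀ x ∈ frontier Ω, ∀ t ∈ Icc 0 T, u x t = φ x t)
    (hinit : ∀ x ∈ closure Ω, u x 0 = φ x 0) (hε : 0 ≤ ε)
    (hnorm : parabolicC2Norm Ω T φ ≤ ENNReal.ofReal ε)
    (hL : (((2 * m + 1) * d + 1) * ε) ^ 2 < 1 / 2) :
    ∀ x ∈ closure Ω, ∀ t ∈ Icc 0 T, ‖spaceDeriv Ω u x t‖ ≤ ((2 * m + 1) * d + 1) * ε := by
  set L := ((2 * m + 1) * d + 1) * ε
  have hL1 : L ≤ 1 := by nlinarith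
  have hεL : ε ≤ L := le_mul_of_one_le_left hε
    (le_add_of_nonneg_left (by have := Metric.diam_nonneg.trans hd; positivity))
  have hsmall : ∀ t ∈ Icc 0 T, ∀ x ∈ closure Ω, ‖spaceDeriv Ω u x t‖ ^ 2 < 1 / 2 := by
    have hcont := (continuousOn_spaceDeriv hT
      (uniqueDiffOn_closure_of_isOpen_of_convex hΩ hconv) hu.c1_closure).norm.pow 2
    refine forall_lt_of_forall_lt_before (f := fun x t => ‖spaceDeriv Ω u x t‖ ^ 2)
      hbdd.isCompact_closure hcont fun t ht hbefore x hx => ?_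
    have hxt : ‖spaceDeriv Ω u x t‖ ≤ L := by
      rcases ht.1.eq_or_lt with rfl | ht0
      · rw [spaceDeriv, fderivWithin_congr hinit (hinit x hx)]
        exact (norm_spaceDeriv_le_of_parabolicC2Norm_le hε hnorm hx ht).trans hεL
      · exact norm_spaceDeriv_le_of_forall_Ico_sq_le_half hu hφ hΩ hconv hbdd hd hbdry hinit hε
          hnorm hL1 ⟨ht0, ht.2⟩ hbefore x hx t (right_mem_Icc.2 ht.1)
    exact (pow_le_pow_left₀ (norm_nonneg _) hxt 2).trans_lt hL
  exact norm_spaceDeriv_le_of_forall_Ico_sq_le_half hu hφ hΩ hconv hbdd hd hbdry hinit hε hnorm hL1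
    (right_mem_Ioc.2 hT) fun s hs => hsmall s (Ico_subset_Icc_self hs)

end Gradient

theorem iSup_tripleNorm_sq_lt {m n : ℕ} {Ω : Set (EuclideanSpace ℝ (Fin m))} {t L c : ℝ}
    {u : EuclideanSpace ℝ (Fin m) → ℝ → EuclideanSpace ℝ (Fin n)} (hL : 0 ≤ L) (hc : L ^ 2 < c)
    (hD : ∀ x ∈ Ω, ‖spaceDeriv Ω u x t‖ ≤ L) :
    ⨆ x ∈ Ω, tripleNorm (spaceDeriv Ω u x t) ^ 2 < ENNReal.ofReal c := by
  refine (iSup₂_le fun x hx => ?_).trans_lt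
    ((ENNReal.ofReal_lt_ofReal_iff ((sq_nonneg L).trans_lt hc)).2 hc)
  rw [ENNReal.ofReal_pow hL]
  gcongr
  refine (tripleNorm_le _).trans ?_
  rw [← ofReal_norm]
  exact ENNReal.ofReal_le_ofReal (hD x hx)

theorem mainTheorem5_general (m : ℕ) {κ : ℝ} (hκ : κ < 1) {d : ℝ} (hd : 0 ≤ d) :
    ∃ ε : ℝ, 0 < ε ∧
      ∀ (n : ℕ) (Ω : Set (EuclideanSpace ℝ (Fin m))), IsOpen Ω → Convex ℝ Ω →
      Bornology.IsBounded Ω → Metric.diam Ω ≤ d →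
      ∀ (T : ℝ), 0 < T →
      ∀ (φ u : EuclideanSpace ℝ (Fin m) → ℝ → EuclideanSpace ℝ (Fin n)),
        IsParabolicC2 Ω T φ →
        IsGraphicMCF Ω T u →
        (∀ x ∈ frontier Ω, ∀ t ∈ Icc 0 T, u x t = φ x t) →
        (∀ x ∈ closure Ω, u x 0 = φ x 0) →
        parabolicC2Norm Ω T φ < ENNReal.ofReal ε →
        ∀ t ∈ Icc 0 T, (⨆ x ∈ Ω, tripleNorm (spaceDeriv Ω u x t) ^ 2) < ENNReal.ofReal (1 - κ) := by
  set L := min (1 / 2) (1 - κ)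
  have hL0 : 0 < L := lt_min one_half_pos (sub_pos.2 hκ)
  have hL : L ^ 2 < L :=
    pow_lt_self_of_lt_one₀ hL0 ((min_le_left _ _).trans_lt one_half_lt_one) one_lt_two
  have hC : 0 < (2 * m + 1) * d + 1 := by positivity
  refine ⟨L / ((2 * m + 1) * d + 1), by positivity, ?_⟩
  intro n Ω hΩ hconv hbdd hdiam T hT φ u hφ hu hbdry hinit hnorm t ht
  have hgradient := norm_spaceDeriv_le hu hφ hT hΩ hconv hbdd hdiam hbdry hinit (by positivity)
    hnorm.le (by rw [mul_div_cancel₀ _ hC.ne']; exact hL.trans_le (min_le_left _ _))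
  rw [mul_div_cancel₀ _ hC.ne'] at hgradient
  exact iSup_tripleNorm_sq_lt hL0.le (hL.trans_le (min_le_right _ _)) fun x hx =>
    hgradient x (subset_closure hx) t ht

theorem mainTheorem5 (m : ℕ) (hm : 2 ≤ m) (κ : ℝ) (hκ : κ ∈ Ioo (0 : ℝ) 1) (d : ℝ) (hd : 0 < d) :
    ∃ ε : ℝ, 0 < ε ∧
      ∀ (n : ℕ), 1 ≤ n →
      ∀ (Ω : Set (EuclideanSpace ℝ (Fin m))), IsBoundedConvexC2Domain Ω → Metric.diam Ω ≤ d →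
      ∀ (T : ℝ), 0 < T →
      ∀ (φ u : EuclideanSpace ℝ (Fin m) → ℝ → EuclideanSpace ℝ (Fin n)),
        IsParabolicC2 Ω T φ →
        IsSpacelikeGraphicMCF Ω T u →
        (∀ x ∈ frontier Ω, ∀ t ∈ Icc 0 T, u x t = φ x t) →
        (∀ x ∈ closure Ω, u x 0 = φ x 0) →
        parabolicC2Norm Ω T φ < ENNReal.ofReal ε →
        ∀ t ∈ Icc 0 T, (⨆ x ∈ Ω, tripleNorm (spaceDeriv Ω u x t) ^ 2) < ENNReal.ofReal (1 - κ) := by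
  obtain ⟨ε, hε, h⟩ := mainTheorem5_general m hκ.2 hd.le
  exact ⟨ε, hε, fun n _ Ω hΩ hdiam T hT φ u hφ hu =>
    h n Ω hΩ.isOpen hΩ.convex hΩ.isBounded hdiam T hT φ u hφ hu.isGraphicMCF⟩
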